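/- Let $(\Omega,\mathcal A,P)$ be a probability space that carries independent sequences with arbitrary prescribed laws, and let $\mathbb L\subset L^1(P)$ be a rearrangement invariant Banach space of random variables on it, i.e. a Banach function space (a complete normed ideal of measurable functions) with $L^\infty\subset\mathbb L$, whose norm depends only on the distribution and whose associate space is norming (equivalently, $\|f_n\|_{\mathbb L}\to\|f\|_{\mathbb L}$ whenever $0\le f_n\uparrow f\in\mathbb L$). Let $E$ be a real Banach space and put $\|\theta\|=\big\|\,\|\theta\|_E\,\big\|_{\mathbb L}$ for $E$-valued random variables $\theta$. We write $\theta\in\mathbb L(E)$ if $\|\theta\|<\infty$. Let $k\ge1$ and let $F=(F_{i_1\dots i_k})_{(i_1,\dots,i_k)\in\mathbb N^k}$ be an array of strongly Borel measurable functions $F_{i_1\dots i_k}:\mathbb R^k\to E$ such that $F_{i_1\dots i_k}=0$ whenever two of the indices coincide, and $F_{i_1\dots i_k}=0$ for all but finitely many $(i_1,\dots,i_k)$. For sequences $x_1,\dots,x_k$ of reals put $$F(x_1,\dots,x_k)=\sum_{i_1,\dots,i_k}F_{i_1\dots i_k}(x_{1i_1},\dots,x_{ki_k}),$$ and let $\hat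 F$ be the array $$\hat F_{i_1\dots i_k}(t_1,\dots,t_k)=\frac1{k!}\sum_{\sigma}F_{i_{\sigma_1}\dots i_{\sigma_k}}(t_{\sigma_1},\dots,t_{\sigma_k}),$$ the sum being over all permutations $\sigma$ of $\{1,\dots,k\}$. Let $\xi,\xi_1,\dots,\xi_k$ be identically distributed sequences of real random variables, $\xi_j=(\xi_{j1},\xi_{j2},\dots)$, such that $F_{i_1\dots i_k}(\xi_{i_1},\dots,\xi_{i_k})\in\mathbb L(E)$ for all $(i_1,\dots,i_k)$. Write $F(\xi^k)=F(\xi,\dots,\xi)$ and $F(X)=F(\xi_1,\dots,\xi_k)$, $\hat F(X)=\hat F(\xi_1,\dots,\xi_k)$. (A′) If $\xi_1,\dots,\xi_k$ are independent and each of them is a sequence of independent random variables, then $$\|F(\xi^k)\|\le A_k\,\|F(X)\|,\qquad A_k=\sum_{r=0}^k\binom kr(2r)^r ,\qquad (2k)^k\le A_k\le(2k+1)^k .$$ (B′) If $\xi_1,\dots,\xi_k$ are interchangeable (every permutation of $(\xi_1,\dots,\xi_k)$ has the same joint distribution) and the rows $(\xi_{1i},\dots,\xi_{ki})$, $i=1,2,\dots$,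 are independent, then $$\|\hat F(X)\|\le B_k\,\|F(\xi^k)\|,\qquad B_k=\sum_{r=0}^k\binom kr\frac{r^k}{k!},\qquad \frac{k^k}{k!}\le B_k\le 2^k\,\frac{k^k}{k!}.$$ (Here $0^0=1$.) -/

import Mathlib

open MeasureTheory ProbabilityTheory Filter Topology
open scoped ENNReal

/-- The probability space carries independent sequences: every sequence of probability laws on `ℝ`
is the sequence of laws of some independent random variables on `Ω`. -/
def CarriesIndependentSequences {Ω : Type*} [MeasurableSpace Ω] (μ : Measure Ω) : Prop :=
  ∀ ν : ℕ → Measure ℝ, (∀ n, IsProbabilityMeasure (ν n)) →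
    ∃ η : ℕ → Ω → ℝ, (∀ n, Measurable (η n)) ∧ iIndepFun η μ ∧ ∀ n, μ.map (η n) = ν n

/-- A rearrangement invariant Banach space `𝕃` of integrable random variables on `(Ω, μ)`, given by
its norm, extended by the value `∞` off the space: `f ∈ 𝕃` iff `nrm f < ∞`. It is a Banach (Köthe)
function space: an ideal of `L⁰`, complete, with `L^∞ ⊆ 𝕃 ⊆ L¹`; the norm depends on the
distribution only; and the associate space is norming, which is expressed in the equivalent form
that the norm is continuous along increasing sequences whose limit is in `𝕃`. Both the separable
r.i. spaces and the maximal ones (those with the Fatou property) are included.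
Values of `nrm` at non-measurable functions play no role. -/
structure RISpace {Ω : Type*} [MeasurableSpace Ω] (μ : Measure Ω) where
  /-- the norm, equal to `∞` off the space -/
  nrm : (Ω → ℝ) → ℝ≥0∞
  eq_zero : ∀ f : Ω → ℝ, AEMeasurable f μ → nrm f = 0 → f =ᵐ[μ] 0
  smul : ∀ (c : ℝ) (f : Ω → ℝ), AEMeasurable f μ → nrm (fun ω => c * f ω) = ‖c‖ₑ * nrm f
  triangle : ∀ f g : Ω → ℝ, AEMeasurable f μ → AEMeasurable g μ →
    nrm (fun ω => f ω + g ω) ≤ nrm f + nrm g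
  /-- the ideal (lattice) property -/
  mono : ∀ f g : Ω → ℝ, AEMeasurable f μ → AEMeasurable g μ →
    (∀ᵐ ω ∂μ, |f ω| ≤ |g ω|) → nrm f ≤ nrm g
  /-- completeness: absolutely convergent series converge -/
  complete : ∀ f : ℕ → Ω → ℝ, (∀ n, AEMeasurable (f n) μ) → ∑' n, nrm (f n) < ∞ →
    ∃ g : Ω → ℝ, AEMeasurable g μ ∧
      Tendsto (fun n => nrm (fun ω => g ω - ∑ m ∈ Finset.range n, f m ω)) atTop (𝓝 0)
  one_mem : nrm (fun _ => 1) < ∞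
  integrable : ∀ f : Ω → ℝ, AEMeasurable f μ → nrm f < ∞ → Integrable f μ
  /-- rearrangement invariance -/
  law_invariant : ∀ f g : Ω → ℝ, IdentDistrib f g μ μ → nrm f = nrm g
  /-- the associate space is norming -/
  norming : ∀ (f : ℕ → Ω → ℝ) (g : Ω → ℝ), (∀ n, AEMeasurable (f n) μ) → AEMeasurable g μ →
    nrm g < ∞ → (∀ n, ∀ᵐ ω ∂μ, 0 ≤ f n ω) → (∀ᵐ ω ∂μ, Monotone (fun n => f n ω)) →
    (∀ᵐ ω ∂μ, Tendsto (fun n => f n ω) atTop (𝓝 (g ω))) → nrm g ≤ ⨆ n, nrm (f n)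

/-- The norm of `𝕃(E)`: `‖θ‖_{𝕃(E)} = ‖ ‖θ‖_E ‖_𝕃`, equal to `∞` if `θ` is not in `𝕃(E)`. -/
def RISpace.vnorm {Ω : Type*} [MeasurableSpace Ω] {μ : Measure Ω} (L : RISpace μ)
    {E : Type*} [NormedAddCommGroup E] (θ : Ω → E) : ℝ≥0∞ :=
  L.nrm (fun ω => ‖θ ω‖)

/-- The (decoupled) U-statistic `∑_{i₁,…,i_k} F_{i₁…i_k}(x_{1 i₁}, …, x_{k i_k})` at a matrix `x`
with `k` columns `x_1, …, x_k`. The sum has finitely many non-zero terms where it is used. -/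
noncomputable def uStat {k : ℕ} {E : Type*} [AddCommMonoid E]
    (F : (Fin k → ℕ) → (Fin k → ℝ) → E) (x : Fin k → ℕ → ℝ) : E :=
  ∑ᶠ i : Fin k → ℕ, F i (fun j => x j (i j))

/-- The symmetrization
`F̂_{i₁…i_k}(x₁,…,x_k) = (1/k!) ∑_σ F_{i_{σ1}…i_{σk}}(x_{σ1},…,x_{σk})`. -/
noncomputable def symmetrization {k : ℕ} {E : Type*} [AddCommGroup E] [Module ℝ E]
    (F : (Fin k → ℕ) → (Fin k → ℝ) → E) : (Fin k → ℕ) → (Fin k → ℝ) → E :=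
  fun i x => (k.factorial : ℝ)⁻¹ •
    ∑ σ : Equiv.Perm (Fin k), F (fun j => i (σ j)) (fun j => x (σ j))

/-- `ξ₁, …, ξ_k` is an interchangeable family of random sequences: each permutation of it has the
same joint distribution. -/
def Interchangeable {Ω : Type*} [MeasurableSpace Ω] (μ : Measure Ω) {k : ℕ}
    (X : Fin k → ℕ → Ω → ℝ) : Prop :=
  ∀ σ : Equiv.Perm (Fin k),
    IdentDistrib (fun ω (j : Fin k) (i : ℕ) => X (σ j) i ω) (fun ω j i => X j i ω) μ μ

/-- `A_k = ∑_{r=0}^k (k choose r) (2r)^r`. -/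
def decouplingA (k : ℕ) : ℝ :=
  ∑ r ∈ Finset.range (k + 1), (k.choose r : ℝ) * (2 * (r : ℝ)) ^ r

/-- `B_k = ∑_{r=0}^k (k choose r) r^k / k!`. -/
noncomputable def decouplingB (k : ℕ) : ℝ :=
  ∑ r ∈ Finset.range (k + 1), (k.choose r : ℝ) * ((r : ℝ) ^ k / (k.factorial : ℝ))

/-!
Both inequalities compare `F` at several independent columns with `F` at one column through a random
*selection*: a map `J` which chooses one variable from each row. Given `J`, the chosen variables
form a sequence distributed as `ξ` (`identDistrib_selection`), and since the indices of a non-zero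
term are distinct, averaging over `J` treats the choices at these indices as independent
(`exists_selectors`).

For the bound on `F̂(X)`, the polarization identity writes `k! F̂(X)` as
`∑_S (-1)^{k-|S|} ∑_{j ∈ S^k} F(ξ_{j₁}, …, ξ_{j_k})`, and the inner sum is `|S|^k` times the mean of
`F(Z, …, Z)`, where `Z` chooses uniformly from the columns in `S`
(`uStat_symmetrization_eq_sum`). The triangle inequality then gives the constant `B_k`.

For the bound on `F(ξ^k)`, decompose `F = ∑_S F^S` in the manner of Hoeffding,
`F^S = ∑_{U ⊆ S} (-1)^{|S \ U|} e_U`, where `e_U` is the conditional mean given the variables with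
numbers in `U`. If `|S| = r`, then `F^S(ξ^k)` is `r^r` times the mean, over uniform `J` with values
in `S`, of the part of `F^S(ξ^k)` with `J i_l = l` for all `l ∈ S` (`sum_eq_sum_selectedPart`). Such
a part involves one variable of each row only, so it has the same law at the decoupled matrix `X`
(`selectedPart_congr`). There it is an alternating sum of the `2^r` conditional means of `F(X)`
given the variables of the columns `l ∈ U` in the rows with `J = l`, because the terms with an index not
selected cancel (`selectedPart_eq_sum`); so its norm is at most `2^r ‖F(X)‖`. Summation over `S`
gives `A_k`.

The last step needs that conditional means do not increase the norm. A rearrangement invariant space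
need not contain the conditional means of its elements, so this part is carried out with the norm
`RISpace.maxNorm`, which agrees with the given one on the space, has the Fatou property, and is
defined for random variables on every probability space. For it, integrating out an independent
variable is a contraction by the strong law of large numbers (`RISpace.maxNorm_integral_le`).
-/

/-! ### Copies of random variables -/

/-- Every random element of a standard Borel space, defined on any probability space, has a copy on
a probability space that carries a real random variable with each prescribed law. -/
theorem CarriesIndependentSequences.exists_identDistrib {Ω : Type*} [MeasurableSpace Ω]
    {μ : Measure Ω} (hμ : CarriesIndependentSequences μ) {S W : Type*} [MeasurableSpace S]
    {ρ : Measure S} [IsProbabilityMeasure ρ] [MeasurableSpace W] [StandardBorelSpace W] [Nonempty W]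
    {f : S → W} (hf : AEMeasurable f ρ) : ∃ Z : Ω → W, IdentDistrib Z f μ ρ := by
  set e := embeddingReal W
  have he : MeasurableEmbedding e := measurableEmbedding_embeddingReal W
  have hef : AEMeasurable (fun s => e (f s)) ρ := he.measurable.comp_aemeasurable hf
  have : IsProbabilityMeasure (ρ.map (fun s => e (f s))) := Measure.isProbabilityMeasure_map hef
  obtain ⟨η, hη, -, hlaw⟩ := hμ (fun _ => ρ.map (fun s => e (f s))) (fun _ => this)
  have h1 : IdentDistrib (η 0) (fun s => e (f s)) μ ρ := ⟨(hη 0).aemeasurable, hef, hlaw 0⟩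
  refine ⟨fun ω => he.invFun (η 0 ω), ?_⟩
  have h2 := h1.comp he.measurable_invFun
  simpa [Function.comp_def, he.leftInverse_invFun _] using h2

namespace RISpace

variable {Ω : Type*} [MeasurableSpace Ω] {μ : Measure Ω} (L : RISpace μ)

/-! ### The norm of a rearrangement invariant space -/

theorem nrm_zero : L.nrm (fun _ => 0) = 0 := by
  simpa using L.smul 0 (fun _ => 1) aemeasurable_const

theorem nrm_bounded_lt_top {f : Ω → ℝ} (hf : AEMeasurable f μ) (c : ℝ)
    (h : ∀ᵐ ω ∂μ, |f ω| ≤ c) : L.nrm f < ∞ := by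
  refine (L.mono f (fun ω => c * 1) hf aemeasurable_const ?_).trans_lt ?_
  · filter_upwards [h] with ω hω
    simpa using hω.trans (le_abs_self c)
  · rw [L.smul c _ aemeasurable_const]
    exact ENNReal.mul_lt_top (by simp) L.one_mem

section vnorm

variable {E : Type*} [NormedAddCommGroup E]

theorem vnorm_add_le {θ η : Ω → E} (hθ : AEStronglyMeasurable θ μ)
    (hη : AEStronglyMeasurable η μ) : L.vnorm (fun ω => θ ω + η ω) ≤ L.vnorm θ + L.vnorm η := by
  refine (L.mono _ (fun ω => ‖θ ω‖ + ‖η ω‖) (hθ.add hη).norm.aemeasurable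
    (hθ.norm.add hη.norm).aemeasurable ?_).trans
    (L.triangle _ _ hθ.norm.aemeasurable hη.norm.aemeasurable)
  refine ae_of_all _ fun ω => ?_
  rw [abs_of_nonneg (norm_nonneg _), abs_of_nonneg (by positivity)]
  exact norm_add_le _ _

theorem vnorm_sum_le {ι : Type*} (s : Finset ι) {θ : ι → Ω → E}
    (hθ : ∀ i, AEStronglyMeasurable (θ i) μ) :
    L.vnorm (fun ω => ∑ i ∈ s, θ i ω) ≤ ∑ i ∈ s, L.vnorm (θ i) := by
  classical
  induction s using Finset.induction_on with
  | empty => simp [vnorm, L.nrm_zero]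
  | insert a s ha ih =>
    simp only [Finset.sum_insert ha]
    exact (L.vnorm_add_le (hθ a) (Finset.aestronglyMeasurable_fun_sum s fun i _ => hθ i)).trans
      (by gcongr)

theorem vnorm_smul [NormedSpace ℝ E] (c : ℝ) {θ : Ω → E} (hθ : AEStronglyMeasurable θ μ) :
    L.vnorm (fun ω => c • θ ω) = ‖c‖ₑ * L.vnorm θ := by
  simp only [vnorm, norm_smul]
  rw [L.smul _ _ hθ.norm.aemeasurable]
  simp

theorem vnorm_eq_of_identDistrib {M : Type*} [MeasurableSpace M] {θ : M → E}
    (hθ : StronglyMeasurable θ) {Y Z : Ω → M} (h : IdentDistrib Y Z μ μ) :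
    L.vnorm (fun ω => θ (Y ω)) = L.vnorm (fun ω => θ (Z ω)) :=
  L.law_invariant _ _ (h.comp hθ.norm.measurable)

end vnorm

/-! ### The norm with the Fatou property -/

theorem abs_min_abs_natCast (x : ℝ) (n : ℕ) : |min |x| (n : ℝ)| = min |x| n :=
  abs_of_nonneg (by positivity)

/-- The norm with the Fatou property that agrees with the norm of `𝕃` on `L^∞`, as a functional of a
random variable `f` on an arbitrary probability space `(S, ρ)`: the supremum of the norms of copies
on `Ω` of the truncations `min |f| n`. -/
noncomputable def maxNorm {S : Type*} [MeasurableSpace S] (ρ : Measure S) (f : S → ℝ) : ℝ≥0∞ :=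
  ⨆ n : ℕ, ⨆ (η : Ω → ℝ) (_ : IdentDistrib η (fun s => min |f s| n) μ ρ), L.nrm η

theorem maxNorm_eq_of_identDistrib {S S' : Type*} [MeasurableSpace S] [MeasurableSpace S']
    {ρ : Measure S} {ρ' : Measure S'} {f : S → ℝ} {g : S' → ℝ} (h : IdentDistrib f g ρ ρ') :
    L.maxNorm ρ f = L.maxNorm ρ' g := by
  have h' : ∀ n : ℕ, IdentDistrib (fun s => min |f s| n) (fun s => min |g s| n) ρ ρ' := fun n =>
    h.comp (u := fun x : ℝ => min |x| n) (by fun_prop)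
  refine iSup_congr fun n => iSup_congr fun η => iSup_congr_Prop ?_ fun _ => rfl
  exact ⟨fun hη => hη.trans (h' n), fun hη => hη.trans (h' n).symm⟩

theorem maxNorm_eq_iSup {f : Ω → ℝ} (hf : AEMeasurable f μ) :
    L.maxNorm μ f = ⨆ n : ℕ, L.nrm (fun ω => min |f ω| n) := by
  refine iSup_congr fun n => le_antisymm (iSup₂_le fun η hη => (L.law_invariant _ _ hη).le) ?_
  exact le_iSup₂_of_le (fun ω => min |f ω| n) (.refl (by fun_prop)) le_rfl

theorem maxNorm_le_nrm {f : Ω → ℝ} (hf : AEMeasurable f μ) : L.maxNorm μ f ≤ L.nrm f := by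
  rw [L.maxNorm_eq_iSup hf]
  refine iSup_le fun n => L.mono _ _ (by fun_prop) hf (ae_of_all _ fun ω => ?_)
  rw [abs_min_abs_natCast]
  exact min_le_left _ _

/-- On the space `𝕃` the two norms agree, since the associate space of `𝕃` is norming. -/
theorem maxNorm_eq_nrm {f : Ω → ℝ} (hf : AEMeasurable f μ) (hfin : L.nrm f < ∞) :
    L.maxNorm μ f = L.nrm f := by
  refine le_antisymm (L.maxNorm_le_nrm hf) ?_
  have habs : L.nrm f ≤ L.nrm (fun ω => |f ω|) :=
    L.mono _ _ hf (by fun_prop) (ae_of_all _ fun ω => by simp)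
  have habs' : L.nrm (fun ω => |f ω|) ≤ L.nrm f :=
    L.mono _ _ (by fun_prop) hf (ae_of_all _ fun ω => by simp)
  rw [L.maxNorm_eq_iSup hf]
  refine habs.trans (L.norming _ _ (fun n => by fun_prop) (by fun_prop) (habs'.trans_lt hfin)
    (fun n => ae_of_all _ fun ω => by positivity) (ae_of_all _ fun ω m n hmn => ?_)
    (ae_of_all _ fun ω => ?_))
  · exact min_le_min_left _ (Nat.cast_le.2 hmn)
  · refine tendsto_const_nhds.congr' ?_
    filter_upwards [eventually_ge_atTop ⌈|f ω|⌉₊] with n hn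
    exact (min_eq_left (Nat.ceil_le.mp hn)).symm

theorem maxNorm_zero {S : Type*} [MeasurableSpace S] {ρ : Measure S} :
    L.maxNorm ρ (fun _ => 0) = 0 := by
  refine le_antisymm (iSup_le fun n => iSup₂_le fun η hη => ?_) zero_le
  have h : ∀ᵐ ω ∂μ, η ω = 0 := hη.symm.ae_snd (p := fun x => x = 0)
    (measurableSet_singleton 0) (ae_of_all _ (by simp))
  refine (L.mono η (fun _ => 0) hη.aemeasurable_fst aemeasurable_const ?_).trans L.nrm_zero.le
  filter_upwards [h] with ω hω
  simp [hω]

section Transfer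

variable {S : Type*} [MeasurableSpace S] {ρ : Measure S} [IsProbabilityMeasure ρ]

theorem maxNorm_mono (hμ : CarriesIndependentSequences μ) {f g : S → ℝ} (hf : AEMeasurable f ρ)
    (hg : AEMeasurable g ρ) (h : ∀ᵐ s ∂ρ, |f s| ≤ |g s|) : L.maxNorm ρ f ≤ L.maxNorm ρ g := by
  obtain ⟨Z, hZ⟩ := hμ.exists_identDistrib (hf.prodMk hg)
  have hm := hZ.aemeasurable_fst
  have h' : ∀ᵐ ω ∂μ, |(Z ω).1| ≤ |(Z ω).2| :=
    hZ.symm.ae_snd (p := fun z : ℝ × ℝ => |z.1| ≤ |z.2|)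
      (measurableSet_le (by fun_prop) (by fun_prop)) h
  have h1 : IdentDistrib (fun ω => (Z ω).1) f μ ρ := hZ.comp measurable_fst
  have h2 : IdentDistrib (fun ω => (Z ω).2) g μ ρ := hZ.comp measurable_snd
  rw [← L.maxNorm_eq_of_identDistrib h1, ← L.maxNorm_eq_of_identDistrib h2,
    L.maxNorm_eq_iSup (by fun_prop), L.maxNorm_eq_iSup (by fun_prop)]
  refine iSup_mono fun n => L.mono _ _ (by fun_prop) (by fun_prop) ?_
  filter_upwards [h'] with ω hω
  rw [abs_min_abs_natCast, abs_min_abs_natCast]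
  exact min_le_min_right _ hω

theorem maxNorm_add_le (hμ : CarriesIndependentSequences μ) {f g : S → ℝ} (hf : AEMeasurable f ρ)
    (hg : AEMeasurable g ρ) :
    L.maxNorm ρ (fun s => f s + g s) ≤ L.maxNorm ρ f + L.maxNorm ρ g := by
  obtain ⟨Z, hZ⟩ := hμ.exists_identDistrib (hf.prodMk hg)
  have hm := hZ.aemeasurable_fst
  have h0 := hZ.comp (u := fun z : ℝ × ℝ => z.1 + z.2) (by fun_prop)
  simp only [Function.comp_def] at h0
  have h1 : IdentDistrib (fun ω => (Z ω).1) f μ ρ := hZ.comp measurable_fst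
  have h2 : IdentDistrib (fun ω => (Z ω).2) g μ ρ := hZ.comp measurable_snd
  rw [← L.maxNorm_eq_of_identDistrib h1, ← L.maxNorm_eq_of_identDistrib h2,
    ← L.maxNorm_eq_of_identDistrib h0, L.maxNorm_eq_iSup (by fun_prop),
    L.maxNorm_eq_iSup (by fun_prop), L.maxNorm_eq_iSup (by fun_prop)]
  refine iSup_le fun n => ?_
  refine (L.mono _ (fun ω => min |(Z ω).1| n + min |(Z ω).2| n) (by fun_prop) (by fun_prop)
    (ae_of_all _ fun ω => ?_)).trans ((L.triangle _ _ (by fun_prop) (by fun_prop)).trans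
      (add_le_add (le_iSup (fun n : ℕ => L.nrm (fun ω => min |(Z ω).1| n)) n)
        (le_iSup (fun n : ℕ => L.nrm (fun ω => min |(Z ω).2| n)) n)))
  have hn : (0 : ℝ) ≤ n := n.cast_nonneg
  rw [abs_min_abs_natCast, abs_of_nonneg (a := min |(Z ω).1| n + _) (by positivity)]
  have h1 := abs_add_le (Z ω).1 (Z ω).2
  have h2 := abs_nonneg (Z ω).1
  have h3 := abs_nonneg (Z ω).2
  simp only [min_def]
  split_ifs <;> linarith

theorem maxNorm_smul_le (hμ : CarriesIndependentSequences μ) (c : ℝ) {f : S → ℝ}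
    (hf : AEMeasurable f ρ) : L.maxNorm ρ (fun s => c * f s) ≤ ‖c‖ₑ * L.maxNorm ρ f := by
  obtain ⟨Z, hZ⟩ := hμ.exists_identDistrib hf
  have hm := hZ.aemeasurable_fst
  have h0 := hZ.comp (u := fun z : ℝ => c * z) (by fun_prop)
  simp only [Function.comp_def] at h0
  rw [← L.maxNorm_eq_of_identDistrib hZ, ← L.maxNorm_eq_of_identDistrib h0,
    L.maxNorm_eq_iSup (by fun_prop), L.maxNorm_eq_iSup (by fun_prop)]
  refine iSup_le fun n => ?_
  rcases eq_or_ne c 0 with rfl | hc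
  · simp [L.nrm_zero]
  have hc' : 0 < |c| := abs_pos.2 hc
  obtain ⟨m, hm'⟩ := exists_nat_ge ((n : ℝ) / |c|)
  refine le_trans ?_ (mul_le_mul_right (le_iSup (fun n : ℕ => L.nrm (fun ω => min |Z ω| n)) m) _)
  rw [← L.smul _ _ (by fun_prop)]
  refine L.mono _ _ (by fun_prop) (by fun_prop) (ae_of_all _ fun ω => ?_)
  rw [abs_mul c (min _ _), abs_min_abs_natCast, abs_min_abs_natCast,
    mul_min_of_nonneg _ _ hc'.le, abs_mul]
  exact min_le_min_left _ (by rw [div_le_iff₀ hc'] at hm'; linarith)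

/-- The Fatou property. -/
theorem maxNorm_le_of_tendsto (hμ : CarriesIndependentSequences μ) {f : ℕ → S → ℝ} {g : S → ℝ}
    (hf : ∀ n, AEMeasurable (f n) ρ) (hg : AEMeasurable g ρ)
    (hlim : ∀ᵐ s ∂ρ, Tendsto (fun n => f n s) atTop (𝓝 (g s))) {C : ℝ≥0∞}
    (hC : ∀ n, L.maxNorm ρ (f n) ≤ C) : L.maxNorm ρ g ≤ C := by
  obtain ⟨Z, hZ⟩ := hμ.exists_identDistrib (hg.prodMk (aemeasurable_pi_lambda _ hf))
  have hm := hZ.aemeasurable_fst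
  have hm2 : ∀ n, AEMeasurable (fun ω => (Z ω).2 n) μ := fun n =>
    ((measurable_pi_apply n).comp measurable_snd).comp_aemeasurable hm
  have hlim' : ∀ᵐ ω ∂μ, Tendsto (fun n => (Z ω).2 n) atTop (𝓝 (Z ω).1) :=
    hZ.symm.ae_snd (p := fun z : ℝ × (ℕ → ℝ) => Tendsto (fun n => z.2 n) atTop (𝓝 z.1))
      (measurableSet_tendsto_fun (fun n => by fun_prop) (by fun_prop)) hlim
  have hC' : ∀ n m : ℕ, L.nrm (fun ω => min |(Z ω).2 n| m) ≤ C := fun n m => by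
    refine le_trans ?_ (hC n)
    have h2 : IdentDistrib (fun ω => (Z ω).2 n) (f n) μ ρ :=
      hZ.comp ((measurable_pi_apply n).comp measurable_snd)
    rw [← L.maxNorm_eq_of_identDistrib h2, L.maxNorm_eq_iSup (hm2 n)]
    exact le_iSup (fun m : ℕ => L.nrm (fun ω => min |(Z ω).2 n| m)) m
  have h1 : IdentDistrib (fun ω => (Z ω).1) g μ ρ := hZ.comp measurable_fst
  rw [← L.maxNorm_eq_of_identDistrib h1, L.maxNorm_eq_iSup (by fun_prop)]
  refine iSup_le fun N => ?_
  -- The truncations of `f n` converge boundedly; their lower envelopes increase to the same limit.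
  set h : ℕ → Ω → ℝ := fun n ω => min |(Z ω).2 n| N with hh
  have h0 : ∀ n ω, 0 ≤ h n ω := fun n ω => by positivity
  have hbdd : ∀ n ω, BddBelow (Set.range fun m => h (n + m) ω) := fun n ω =>
    ⟨0, by rintro _ ⟨m, rfl⟩; exact h0 _ _⟩
  have hmeas : ∀ n, AEMeasurable (h n) μ := fun n => by
    have := hm2 n
    fun_prop
  have henv : ∀ n, AEMeasurable (fun ω => ⨅ m, h (n + m) ω) μ := fun n =>
    AEMeasurable.iInf fun m => hmeas (n + m)
  refine (L.norming (fun n ω => ⨅ m, h (n + m) ω) _ henv (by fun_prop) ?_ ?_ ?_ ?_).trans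
    (iSup_le fun n => ?_)
  · exact L.nrm_bounded_lt_top (by fun_prop) N (ae_of_all _ fun ω => by
      rw [abs_min_abs_natCast]; exact min_le_right _ _)
  · exact fun n => ae_of_all _ fun ω => Real.iInf_nonneg fun m => h0 _ _
  · refine ae_of_all _ fun ω => monotone_nat_of_le_succ fun n => le_ciInf fun m => ?_
    simpa [add_assoc, add_comm 1 m] using ciInf_le (hbdd n ω) (1 + m)
  · filter_upwards [hlim'] with ω hω
    have ht : Tendsto (fun n => h n ω) atTop (𝓝 (min |(Z ω).1| N)) :=
      (hω.abs).min tendsto_const_nhds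
    refine Metric.tendsto_atTop.2 fun ε hε => ?_
    obtain ⟨n₀, hn₀⟩ := Metric.tendsto_atTop.1 ht (ε / 2) (by positivity)
    refine ⟨n₀, fun n hn => ?_⟩
    have hup : ⨅ m, h (n + m) ω ≤ h n ω := by simpa using ciInf_le (hbdd n ω) 0
    have hlow : min |(Z ω).1| N - ε / 2 ≤ ⨅ m, h (n + m) ω := le_ciInf fun m => by
      have := hn₀ (n + m) (by omega)
      rw [Real.dist_eq, abs_lt] at this
      linarith
    have := hn₀ n hn
    rw [Real.dist_eq, abs_lt] at this ⊢
    constructor <;> linarith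
  · refine (L.mono _ _ (henv n) (hmeas n) (ae_of_all _ fun ω => ?_)).trans (hC' n N)
    rw [abs_of_nonneg (Real.iInf_nonneg fun m => h0 _ _), abs_of_nonneg (h0 _ _)]
    simpa using ciInf_le (hbdd n ω) 0

theorem maxNorm_sum_le (hμ : CarriesIndependentSequences μ) {ι : Type*} (s : Finset ι)
    {f : ι → S → ℝ} (hf : ∀ i, AEMeasurable (f i) ρ) :
    L.maxNorm ρ (fun x => ∑ i ∈ s, f i x) ≤ ∑ i ∈ s, L.maxNorm ρ (f i) := by
  classical
  induction s using Finset.induction_on with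
  | empty => simp [L.maxNorm_zero]
  | insert a s ha ih =>
    simp only [Finset.sum_insert ha]
    exact (L.maxNorm_add_le hμ (hf a) (Finset.aemeasurable_fun_sum s fun i _ => hf i)).trans
      (by gcongr)

theorem maxNorm_norm_sum_smul_le (hμ : CarriesIndependentSequences μ) {E : Type*}
    [NormedAddCommGroup E] [NormedSpace ℝ E] {ι : Type*} (s : Finset ι) (c : ι → ℝ)
    {θ : ι → S → E} (hθ : ∀ i, AEStronglyMeasurable (θ i) ρ) :
    L.maxNorm ρ (fun x => ‖∑ i ∈ s, c i • θ i x‖) ≤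
      ∑ i ∈ s, ‖c i‖ₑ * L.maxNorm ρ (fun x => ‖θ i x‖) := by
  have hm : ∀ i, AEMeasurable (fun x => ‖θ i x‖) ρ := fun i => (hθ i).norm.aemeasurable
  have hm' : ∀ i, AEMeasurable (fun x => |c i| * ‖θ i x‖) ρ := fun i => (hm i).const_mul _
  refine (L.maxNorm_mono hμ (g := fun x => ∑ i ∈ s, |c i| * ‖θ i x‖)
    (Finset.aestronglyMeasurable_fun_sum s fun i _ => (hθ i).const_smul _).norm.aemeasurable
    (Finset.aemeasurable_fun_sum s fun i _ => hm' i) (ae_of_all _ fun x => ?_)).trans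
    ((L.maxNorm_sum_le hμ s hm').trans (Finset.sum_le_sum fun i _ => ?_))
  · rw [abs_of_nonneg (norm_nonneg _), abs_of_nonneg (by positivity)]
    refine (norm_sum_le _ _).trans_eq ?_
    simp [norm_smul]
  · simpa using L.maxNorm_smul_le hμ |c i| (hm i)

end Transfer

/-! ### Integrating out an independent variable -/

section Contraction

variable {S T : Type*} [MeasurableSpace S] [MeasurableSpace T] {ρ : Measure S} {τ : Measure T}
  [IsProbabilityMeasure ρ] [IsProbabilityMeasure τ]

/-- Integrating out an independent variable does not increase the norm: by the strong law of large
numbers the integral is the limit of the averages over independent copies of that variable. -/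
theorem maxNorm_integral_le (hμ : CarriesIndependentSequences μ) {f : S × T → ℝ}
    (hf : Measurable f) {c : ℝ} (hc : ∀ z, ‖f z‖ ≤ c) :
    L.maxNorm ρ (fun s => ∫ t, f (s, t) ∂τ) ≤ L.maxNorm (ρ.prod τ) f := by
  set Q : Measure (ℕ → T) := Measure.infinitePi fun _ => τ
  have hint : StronglyMeasurable (fun s => ∫ t, f (s, t) ∂τ) :=
    hf.stronglyMeasurable.integral_prod_right'
  have hlaw : IdentDistrib (fun z : S × (ℕ → T) => ∫ t, f (z.1, t) ∂τ) (fun s => ∫ t, f (s, t) ∂τ)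
      (ρ.prod Q) ρ :=
    IdentDistrib.comp (f := Prod.fst) (g := id) (u := fun s => ∫ t, f (s, t) ∂τ)
      ⟨measurable_fst.aemeasurable, measurable_id.aemeasurable, by simp⟩ hint.measurable
  have hlaw' : ∀ i, IdentDistrib (fun z : S × (ℕ → T) => f (z.1, z.2 i)) f
      (ρ.prod Q) (ρ.prod τ) := fun i => by
    refine IdentDistrib.comp (f := fun z : S × (ℕ → T) => (z.1, z.2 i)) (g := id)
      ⟨by fun_prop, by fun_prop, ?_⟩ hf
    have := Measure.map_prod_map ρ Q measurable_id (measurable_pi_apply i)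
    rw [Measure.infinitePi_map_eval, Measure.map_id] at this
    rw [Measure.map_id, this]
    rfl
  rw [← L.maxNorm_eq_of_identDistrib hlaw]
  have hm : ∀ i, Measurable (fun z : S × (ℕ → T) => f (z.1, z.2 i)) := fun i =>
    hf.comp (by fun_prop)
  have havg : ∀ n : ℕ, Measurable
      (fun z : S × (ℕ → T) => (n : ℝ)⁻¹ * ∑ i ∈ Finset.range n, f (z.1, z.2 i)) := fun n =>
    (Finset.measurable_fun_sum _ fun i _ => hm i).const_mul _
  refine L.maxNorm_le_of_tendsto hμ (fun n => (havg n).aemeasurable) hlaw.aemeasurable_fst ?_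
    fun n => ?_
  · have hint' : Measurable fun z : S × (ℕ → T) => ∫ t, f (z.1, t) ∂τ :=
      hint.measurable.comp measurable_fst
    rw [Measure.ae_prod_iff_ae_ae (measurableSet_tendsto_fun havg hint')]
    refine ae_of_all _ fun s => ?_
    have hms : Measurable (fun t => f (s, t)) := hf.comp (by fun_prop)
    have hid : ∀ i, IdentDistrib (fun y : ℕ → T => f (s, y i)) (fun t => f (s, t)) Q τ := fun i =>
      IdentDistrib.comp (f := fun y : ℕ → T => y i) (g := id) (u := fun t => f (s, t))
        ⟨(measurable_pi_apply i).aemeasurable, by fun_prop,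
          by simpa using Measure.infinitePi_map_eval (fun _ => τ) i⟩ hms
    have hind : iIndepFun (fun (i : ℕ) (y : ℕ → T) => f (s, y i)) Q :=
      iIndepFun_infinitePi (P := fun _ : ℕ => τ) (X := fun _ t => f (s, t)) fun _ => hms
    have h1 := strong_law_ae (μ := Q) (fun (i : ℕ) (y : ℕ → T) => f (s, y i))
      ((hid 0).integrable_iff.2 (Integrable.of_bound hms.aestronglyMeasurable c
        (ae_of_all _ fun t => hc _)))
      (fun i j hij => hind.indepFun hij) (fun i => (hid i).trans (hid 0).symm)
    rw [(hid 0).integral_eq] at h1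
    simpa using h1
  · refine (L.maxNorm_smul_le hμ _ (Finset.measurable_fun_sum _ fun i _ => hm i).aemeasurable).trans
      ((mul_le_mul_right (L.maxNorm_sum_le hμ _ fun i => (hm i).aemeasurable) _).trans ?_)
    simp only [fun i => L.maxNorm_eq_of_identDistrib (hlaw' i), Finset.sum_const, Finset.card_range,
      nsmul_eq_mul]
    rw [← mul_assoc]
    refine mul_le_of_le_one_left' ?_
    rcases eq_or_ne n 0 with rfl | hn
    · simp
    · rw [enorm_inv (by exact_mod_cast hn)]
      simp only [Real.enorm_natCast]
      exact ENNReal.inv_mul_le_one _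

/-- A random variable dominated by the integral of `|f|` over an independent variable has at most
the norm of `f`. No boundedness is needed, thanks to the Fatou property. -/
theorem maxNorm_le_of_le_lintegral (hμ : CarriesIndependentSequences μ) {f : S × T → ℝ}
    (hf : Measurable f) {g : S → ℝ} (hg : AEMeasurable g ρ)
    (h : ∀ᵐ s ∂ρ, ‖g s‖ₑ ≤ ∫⁻ t, ‖f (s, t)‖ₑ ∂τ) :
    L.maxNorm ρ g ≤ L.maxNorm (ρ.prod τ) f := by
  set φ : ℕ → S × T → ℝ := fun m z => min |f z| m
  have hφ : ∀ m, Measurable (φ m) := fun m => by fun_prop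
  have hφ0 : ∀ m z, 0 ≤ φ m z := fun m z => by positivity
  have hφm : ∀ m z, ‖φ m z‖ ≤ m := fun m z => by
    rw [Real.norm_of_nonneg (hφ0 m z)]; exact min_le_right _ _
  set a : ℕ → S → ℝ := fun m s => ∫ t, φ m (s, t) ∂τ
  have ha : ∀ m, Measurable (a m) := fun m =>
    ((hφ m).stronglyMeasurable.integral_prod_right').measurable
  have ha0 : ∀ m s, 0 ≤ a m s := fun m s => integral_nonneg fun t => hφ0 _ _
  have hφs : ∀ m s, Measurable (fun t => φ m (s, t)) := fun m s => (hφ m).comp (by fun_prop)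
  have hai : ∀ m s, Integrable (fun t => φ m (s, t)) τ := fun m s =>
    Integrable.of_bound (hφs m s).aestronglyMeasurable m (ae_of_all _ fun t => hφm _ _)
  have hmono : ∀ s, Monotone fun m => a m s := fun s m n hmn =>
    integral_mono (hai m s) (hai n s) fun t => min_le_min_left _ (Nat.cast_le.2 hmn)
  have hae : ∀ m s, ENNReal.ofReal (a m s) = ∫⁻ t, ENNReal.ofReal (φ m (s, t)) ∂τ := fun m s =>
    ofReal_integral_eq_lintegral_ofReal (hai m s) (ae_of_all _ fun t => hφ0 _ _)
  have hsup : ∀ s, ∫⁻ t, ‖f (s, t)‖ₑ ∂τ = ⨆ m, ENNReal.ofReal (a m s) := fun s => by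
    simp only [hae]
    rw [← lintegral_iSup (fun m => (hφs m s).ennreal_ofReal)
      (fun m n hmn t => ENNReal.ofReal_le_ofReal (min_le_min_left _ (Nat.cast_le.2 hmn)))]
    refine lintegral_congr fun t => le_antisymm ?_ (iSup_le fun m => ?_)
    · refine le_iSup_of_le ⌈|f (s, t)|⌉₊ ?_
      rw [Real.enorm_eq_ofReal_abs]
      exact ENNReal.ofReal_le_ofReal (le_min le_rfl (Nat.le_ceil _))
    · rw [Real.enorm_eq_ofReal_abs]
      exact ENNReal.ofReal_le_ofReal (min_le_left _ _)
  have habs : L.maxNorm ρ g ≤ L.maxNorm ρ (fun s => |g s|) :=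
    L.maxNorm_mono hμ hg (by fun_prop) (ae_of_all _ fun s => by simp)
  have hb : ∀ m, AEMeasurable (fun s => min |g s| (a m s)) ρ := fun m => by
    have := ha m
    fun_prop
  refine habs.trans (L.maxNorm_le_of_tendsto hμ (f := fun m s => min |g s| (a m s)) hb
    (by fun_prop) ?_ fun m => ?_)
  · filter_upwards [h] with s hs
    rw [hsup s, Real.enorm_eq_ofReal_abs] at hs
    refine tendsto_order.2 ⟨fun b hb => ?_, fun b hb => .of_forall fun m =>
      (min_le_left _ _).trans_lt hb⟩
    rcases lt_or_ge b 0 with hb0 | hb0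
    · exact .of_forall fun m => hb0.trans_le (le_min (abs_nonneg _) (ha0 m s))
    obtain ⟨m, hm⟩ := lt_iSup_iff.1
      (((ENNReal.ofReal_lt_ofReal_iff (hb0.trans_lt hb)).2 hb).trans_le hs)
    filter_upwards [eventually_ge_atTop m] with n hn
    exact lt_min hb (((ENNReal.ofReal_lt_ofReal_iff_of_nonneg hb0).1 hm).trans_le (hmono s hn))
  · refine (L.maxNorm_mono hμ (hb m) (ha m).aemeasurable (ae_of_all _ fun s => ?_)).trans
      ((L.maxNorm_integral_le hμ (hφ m) (hφm m)).trans
        (L.maxNorm_mono hμ (hφ m).aemeasurable hf.aemeasurable (ae_of_all _ fun z => ?_)))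
    · rw [abs_of_nonneg (le_min (abs_nonneg _) (ha0 m s)), abs_of_nonneg (ha0 m s)]
      exact min_le_right _ _
    · rw [abs_of_nonneg (hφ0 m z)]
      exact min_le_left _ _

end Contraction

end RISpace

/-! ### Alternating sums -/

section Alternating

variable {k : ℕ}

theorem sum_superset_neg_one_pow (U : Finset (Fin k)) :
    ∑ S : Finset (Fin k) with U ⊆ S, (-1 : ℝ) ^ S.card =
      if U = Finset.univ then (-1) ^ k else 0 := by
  have h : ∑ S : Finset (Fin k) with U ⊆ S, (-1 : ℝ) ^ S.card =
      ∑ V ∈ Uᶜ.powerset, (-1 : ℝ) ^ U.card * (-1) ^ V.card := by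
    refine Finset.sum_nbij' (fun S => S \ U) (fun V => U ∪ V) ?_ ?_ ?_ ?_ ?_
    · intro S _
      simp only [Finset.mem_powerset]
      intro l
      simp
    · simp
    · intro S hS
      exact Finset.union_sdiff_of_subset (by simpa using hS)
    · intro V hV
      rw [Finset.union_sdiff_cancel_left]
      exact Finset.disjoint_left.2 fun l hl hl' => by
        simpa [hl] using Finset.mem_powerset.1 hV hl'
    · intro S hS
      rw [← pow_add, add_comm, Finset.card_sdiff_add_card_eq_card (by simpa using hS)]
  rw [h, ← Finset.mul_sum]
  have h2 := congrArg (Int.cast (R := ℝ)) (Finset.sum_powerset_neg_one_pow_card (x := Uᶜ))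
  push_cast at h2
  rw [h2]
  by_cases hU : U = Finset.univ
  · simp [hU]
  · simp [hU]

variable {E : Type*} [AddCommGroup E] [Module ℝ E]

/-- Möbius inversion on the lattice of subsets of `{1, …, k}`. -/
theorem sum_sum_powerset_neg_one_pow (e : Finset (Fin k) → E) :
    ∑ S : Finset (Fin k), ∑ U ∈ S.powerset, (-1 : ℝ) ^ (S.card + U.card) • e U =
      e Finset.univ := by
  have h : ∑ S : Finset (Fin k), ∑ U ∈ S.powerset, (-1 : ℝ) ^ (S.card + U.card) • e U =
      ∑ U : Finset (Fin k), ∑ S : Finset (Fin k) with U ⊆ S,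
        (-1 : ℝ) ^ (S.card + U.card) • e U :=
    Finset.sum_comm' (by simp)
  rw [h, Finset.sum_eq_single Finset.univ]
  · rw [← Finset.sum_smul]
    simp_rw [pow_add]
    rw [← Finset.sum_mul, sum_superset_neg_one_pow]
    simp [← pow_add, ← two_mul]
  · intro U _ hU
    rw [← Finset.sum_smul]
    simp_rw [pow_add]
    rw [← Finset.sum_mul, sum_superset_neg_one_pow]
    simp [hU]
  · simp

/-- An alternating sum over the subsets of `S` vanishes if its terms depend only on a proper part
of `S`. -/
theorem sum_powerset_neg_one_pow_filter_eq_zero (e : Finset (Fin k) → E) (S : Finset (Fin k))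
    (p : Fin k → Prop) [DecidablePred p] (hp : ¬ ∀ l ∈ S, p l) :
    ∑ U ∈ S.powerset, (-1 : ℝ) ^ (S.card + U.card) • e (U.filter p) = 0 := by
  push Not at hp
  obtain ⟨l, hl, hpl⟩ := hp
  obtain ⟨S', hS', rfl⟩ : ∃ S', l ∉ S' ∧ insert l S' = S :=
    ⟨S.erase l, by simp, Finset.insert_erase hl⟩
  rw [Finset.sum_powerset_insert hS', ← Finset.sum_add_distrib]
  refine Finset.sum_eq_zero fun U hU => ?_
  have hlU : l ∉ U := fun h => hS' (Finset.mem_powerset.1 hU h)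
  rw [Finset.filter_insert, if_neg hpl, Finset.card_insert_of_notMem hlU, ← add_assoc, pow_succ]
  simp

/-- The sum over all permutations by inclusion-exclusion over the maps into subsets: the
polarization identity. -/
theorem sum_perm_eq_sum_piFinset (g : (Fin k → Fin k) → E) :
    ∑ σ : Equiv.Perm (Fin k), g σ =
      ∑ S : Finset (Fin k), (-1 : ℝ) ^ (k + S.card) • ∑ j ∈ Fintype.piFinset fun _ => S, g j := by
  have h : ∑ S : Finset (Fin k), (-1 : ℝ) ^ (k + S.card) • ∑ j ∈ Fintype.piFinset fun _ => S, g j =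
      ∑ j : Fin k → Fin k, ∑ S : Finset (Fin k) with Finset.univ.image j ⊆ S,
        (-1 : ℝ) ^ (k + S.card) • g j := by
    simp_rw [Finset.smul_sum]
    refine Finset.sum_comm' fun S j => ?_
    simp [Finset.image_subset_iff]
  have h2 : ∀ j : Fin k → Fin k, ∑ S : Finset (Fin k) with Finset.univ.image j ⊆ S,
      (-1 : ℝ) ^ (k + S.card) • g j = if Function.Surjective j then g j else 0 := fun j => by
    rw [← Finset.sum_smul]
    simp_rw [pow_add]
    have hsurj : Finset.univ.image j = Finset.univ ↔ Function.Surjective j := by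
      rw [← Finset.coe_inj]
      simp [Set.range_eq_univ]
    rw [← Finset.mul_sum, sum_superset_neg_one_pow]
    simp only [hsurj]
    split_ifs
    · simp [← pow_add, ← two_mul]
    · simp
  rw [h, Finset.sum_congr rfl fun j _ => h2 j, ← Finset.sum_filter]
  refine Finset.sum_bij (fun σ _ => ⇑σ) (fun σ _ => by simpa using σ.surjective)
    (fun σ _ τ _ h => DFunLike.coe_injective h) (fun j hj => ?_) (fun _ _ => rfl)
  have hj' : Function.Surjective j := by simpa using hj
  exact ⟨Equiv.ofBijective j (Finite.surjective_iff_bijective.1 hj'), by simp, rfl⟩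

end Alternating

/-! ### Selectors -/

/-- Finitely many maps `J : ℕ → T` that behave like a sequence of independent choices from `T` at
the indices that occur in the tuples `i ∈ Φ`: prescribed values at `r` distinct indices are taken by
the fraction `|T|⁻ʳ` of these maps. -/
theorem exists_selectors {k : ℕ} (Φ : Finset (Fin k → ℕ)) {T : Finset (Fin k)} (hT : T.Nonempty) :
    ∃ 𝒥 : Finset (ℕ → Fin k), 𝒥.Nonempty ∧ (∀ J ∈ 𝒥, ∀ a, J a ∈ T) ∧
      ∀ i ∈ Φ, Function.Injective i → ∀ (S : Finset (Fin k)) (j : Fin k → Fin k),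
        (∀ l ∈ S, j l ∈ T) →
        (𝒥.filter fun J => ∀ l ∈ S, J (i l) = j l).card * T.card ^ S.card = 𝒥.card := by
  classical
  obtain ⟨t₀, ht₀⟩ := hT
  obtain ⟨n, hn⟩ : ∃ n, ∀ i ∈ Φ, ∀ l, i l < n := by
    refine ⟨(Φ.sup fun i => Finset.univ.sup i) + 1, fun i hi l => Nat.lt_succ_of_le ?_⟩
    exact (Finset.le_sup (f := i) (Finset.mem_univ l)).trans
      (Finset.le_sup (f := fun i => Finset.univ.sup i) hi)
  let ext : (Fin n → Fin k) → ℕ → Fin k := fun J a => if h : a < n then J ⟨a, h⟩ else t₀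
  have hext : Function.Injective ext := fun J J' h => funext fun a => by
    simpa [ext] using congrFun h a
  refine ⟨(Fintype.piFinset fun _ => T).image ext, ?_, ?_, ?_⟩
  · exact ⟨ext fun _ => t₀, Finset.mem_image_of_mem _ (by simpa using fun _ => ht₀)⟩
  · intro J hJ a
    obtain ⟨J', hJ', rfl⟩ := Finset.mem_image.1 hJ
    simp only [ext]
    split_ifs
    exacts [Fintype.mem_piFinset.1 hJ' _, ht₀]
  · intro i hi hinj S j hj
    let i' : Fin k → Fin n := fun l => ⟨i l, hn i hi l⟩
    have hinj' : Function.Injective i' := fun l l' h => hinj (by simpa [i'] using h)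
    have hfil : ((Fintype.piFinset fun _ => T).image ext).filter (fun J => ∀ l ∈ S, J (i l) = j l) =
        (Fintype.piFinset fun a : Fin n => T.filter fun t => ∀ l ∈ S, i' l = a → t = j l).image
          ext := by
      rw [Finset.filter_image]
      congr 1
      ext J
      simp only [Finset.mem_filter, Fintype.mem_piFinset, ext, hn i hi]
      constructor
      · rintro ⟨h1, h2⟩ a
        exact ⟨h1 a, by rintro l hl rfl; simpa using h2 l hl⟩
      · exact fun h => ⟨fun a => (h a).1, fun l hl => by simpa using (h (i' l)).2 l hl rfl⟩
    rw [hfil, Finset.card_image_of_injective _ hext, Finset.card_image_of_injective _ hext,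
      Fintype.card_piFinset, Fintype.card_piFinset]
    have hcard : ∀ a : Fin n, (T.filter fun t => ∀ l ∈ S, i' l = a → t = j l).card =
        if a ∈ S.image i' then 1 else T.card := fun a => by
      split_ifs with ha
      · obtain ⟨l, hl, rfl⟩ := Finset.mem_image.1 ha
        rw [Finset.card_eq_one]
        refine ⟨j l, Finset.ext fun t => ?_⟩
        simp only [Finset.mem_filter, Finset.mem_singleton]
        constructor
        · exact fun h => h.2 l hl rfl
        · rintro rfl
          exact ⟨hj l hl, fun l' _ h => by rw [hinj' h]⟩
      · rw [Finset.filter_true_of_mem]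
        exact fun t _ l hl h => absurd (Finset.mem_image.2 ⟨l, hl, h⟩) ha
    rw [Finset.prod_congr rfl fun a _ => hcard a, Finset.prod_ite, Finset.prod_const_one, one_mul,
      Finset.prod_const, ← pow_add, ← Finset.card_image_of_injective S hinj', Finset.prod_const,
      Finset.card_univ]
    congr 1
    rw [add_comm, ← Finset.card_univ,
      ← Finset.card_filter_add_card_filter_not (s := Finset.univ) (· ∈ S.image i')]
    congr 2
    ext
    simp

/-! ### U-statistics -/

section UStat

theorem uStat_eq_sum {k : ℕ} {E : Type*} [AddCommGroup E]
    {F : (Fin k → ℕ) → (Fin k → ℝ) → E} (hF : (Function.support F).Finite)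
    (x : Fin k → ℕ → ℝ) : uStat F x = ∑ i ∈ hF.toFinset, F i fun j => x j (i j) :=
  finsum_eq_sum_of_support_subset _ fun i hi => by
    simp only [Set.Finite.coe_toFinset, Function.mem_support] at hi ⊢
    exact fun h => hi (by simp [h])

variable {k : ℕ} {E : Type*} [AddCommGroup E] [Module ℝ E]

theorem uStat_symmetrization {F : (Fin k → ℕ) → (Fin k → ℝ) → E}
    (hF : (Function.support F).Finite) (x : Fin k → ℕ → ℝ) :
    uStat (symmetrization F) x =
      (k.factorial : ℝ)⁻¹ • ∑ σ : Equiv.Perm (Fin k), uStat F fun j => x (σ j) := by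
  have hperm : ∀ σ : Equiv.Perm (Fin k),
      uStat F (fun j => x (σ j)) =
        ∑ᶠ i : Fin k → ℕ, F (fun j => i (σ j)) fun j => x (σ j) (i (σ j)) :=
    fun σ => (finsum_comp_equiv (f := fun i => F i fun j => x (σ j) (i j))
      (Equiv.arrowCongr σ.symm (Equiv.refl ℕ))).symm
  have hfin : ∀ σ : Equiv.Perm (Fin k), (Function.support fun i : Fin k → ℕ =>
      F (fun j => i (σ j)) fun j => x (σ j) (i (σ j))).Finite := fun σ => by
    refine (hF.preimage (f := fun i : Fin k → ℕ => fun j => i (σ j)) ?_).subset fun i hi h => ?_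
    · exact (Function.Surjective.injective_comp_right σ.surjective).injOn
    · exact hi (by simp [h])
  simp only [hperm]
  rw [← finsum_sum_comm _ _ fun σ _ => hfin σ, smul_finsum]
  rfl

/-- The polarization identity in probabilistic form: `F̂(X)` is a linear combination of averages,
over choices `J` of one variable from each row, of the values of `F` on the diagonal. -/
theorem uStat_symmetrization_eq_sum {F : (Fin k → ℕ) → (Fin k → ℝ) → E} (hk : 0 < k)
    (hF0 : ∀ i : Fin k → ℕ, ¬ Function.Injective i → F i = 0)
    (hF : (Function.support F).Finite) :
    ∃ 𝒥 : Finset (Fin k) → Finset (ℕ → Fin k), (∀ S, (𝒥 S).Nonempty) ∧ ∀ x : Fin k → ℕ → ℝ,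
      uStat (symmetrization F) x = ∑ S : Finset (Fin k),
        ((k.factorial : ℝ)⁻¹ * ((-1) ^ (k + S.card) * ((S.card : ℝ) ^ k / (𝒥 S).card))) •
          ∑ J ∈ 𝒥 S, uStat F fun _ a => x (J a) a := by
  have : NeZero k := ⟨hk.ne'⟩
  have hex : ∀ S : Finset (Fin k), ∃ 𝒥 : Finset (ℕ → Fin k), 𝒥.Nonempty ∧ (S.Nonempty →
      (∀ J ∈ 𝒥, ∀ a, J a ∈ S) ∧ ∀ i ∈ hF.toFinset, Function.Injective i →
        ∀ j : Fin k → Fin k, (∀ l, j l ∈ S) →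
          (𝒥.filter fun J => ∀ l, J (i l) = j l).card * S.card ^ k = 𝒥.card) := fun S => by
    -- There is no choice from the empty set; its coefficient is `0 ^ k = 0`.
    rcases S.eq_empty_or_nonempty with rfl | hS
    · exact ⟨{fun _ => 0}, by simp, by simp⟩
    · obtain ⟨𝒥, h1, h2, h3⟩ := exists_selectors hF.toFinset hS
      exact ⟨𝒥, h1, fun _ => ⟨h2, fun i hi hinj j hj => by
        simpa using h3 i hi hinj Finset.univ j (by simpa using hj)⟩⟩
  choose 𝒥 h𝒥 hJ using hex
  refine ⟨𝒥, h𝒥, fun x => ?_⟩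
  rw [uStat_symmetrization hF, sum_perm_eq_sum_piFinset (fun j => uStat F fun l => x (j l)),
    Finset.smul_sum]
  refine Finset.sum_congr rfl fun S _ => ?_
  rw [mul_smul, mul_smul]
  congr 2
  rcases S.eq_empty_or_nonempty with rfl | hS
  · simp [hk.ne']
  obtain ⟨hmem, hcard⟩ := hJ S hS
  simp only [uStat_eq_sum hF]
  rw [Finset.sum_comm, Finset.sum_comm (s := 𝒥 S), Finset.smul_sum]
  refine Finset.sum_congr rfl fun i hi => ?_
  have hinj : Function.Injective i := by
    by_contra h
    exact (hF.mem_toFinset.1 hi) (hF0 i h)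
  rw [← Finset.sum_fiberwise_of_maps_to (s := 𝒥 S) (t := Fintype.piFinset fun _ => S)
    (g := fun J l => J (i l)) fun J hJ => Fintype.mem_piFinset.2 fun l => hmem J hJ _,
    Finset.smul_sum]
  refine Finset.sum_congr rfl fun j hj => ?_
  have h1 : ∑ J ∈ 𝒥 S with (fun l => J (i l)) = j, F i (fun l => x (J (i l)) (i l)) =
      ∑ J ∈ 𝒥 S with (fun l => J (i l)) = j, F i fun l => x (j l) (i l) := by
    refine Finset.sum_congr rfl fun J hJ => ?_
    simp only [← (Finset.mem_filter.1 hJ).2]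
  have h2 := hcard i hi hinj j fun l => Fintype.mem_piFinset.1 hj l
  rw [h1, Finset.sum_const, ← Nat.cast_smul_eq_nsmul ℝ, smul_smul, ← h2]
  simp only [funext_iff]
  have h3 : ((𝒥 S).card : ℝ) ≠ 0 := by exact_mod_cast (h𝒥 S).card_pos.ne'
  rw [← h2] at h3
  push_cast at h3 ⊢
  rw [show (S.card : ℝ) ^ k / (_ * _) * _ = 1 by
    rw [div_mul_eq_mul_div, mul_comm, div_self h3], one_smul]

end UStat

/-! ### The Hoeffding decomposition -/

section Hoeffding

variable {k : ℕ} {E : Type*} [AddCommGroup E] [Module ℝ E]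

/-- The part of the `S`-component `∑_{U ⊆ S} (-1)^{|S \ U|} e U` of a U-statistic in which, for each
`l ∈ S`, the `l`-th index belongs to the class `{a | J a = l}`. Here `e U i` is to be the conditional
mean of `F i` given the variables with numbers in `U`, a function of these variables only. -/
noncomputable def selectedPart (e : Finset (Fin k) → (Fin k → ℕ) → (Fin k → ℝ) → E)
    (Φ : Finset (Fin k → ℕ)) (S : Finset (Fin k)) (J : ℕ → Fin k) (x : Fin k × ℕ → ℝ) : E :=
  ∑ i ∈ Φ, if ∀ l ∈ S, J (i l) = l then
    ∑ U ∈ S.powerset, (-1 : ℝ) ^ (S.card + U.card) • e U i fun l => x (l, i l) else 0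

/-- The tuples with unselected indices cancel, so that a selected part is an alternating sum of
conditional means of the whole U-statistic. -/
theorem selectedPart_eq_sum (e : Finset (Fin k) → (Fin k → ℕ) → (Fin k → ℝ) → E)
    (Φ : Finset (Fin k → ℕ)) (S : Finset (Fin k)) (J : ℕ → Fin k) (x : Fin k × ℕ → ℝ) :
    selectedPart e Φ S J x = ∑ U ∈ S.powerset, (-1 : ℝ) ^ (S.card + U.card) •
      ∑ i ∈ Φ, e (U.filter fun l => J (i l) = l) i fun l => x (l, i l) := by
  simp_rw [Finset.smul_sum]
  rw [Finset.sum_comm]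
  refine Finset.sum_congr rfl fun i _ => ?_
  split_ifs with h
  · refine Finset.sum_congr rfl fun U hU => ?_
    rw [Finset.filter_true_of_mem fun l hl => h l (Finset.mem_powerset.1 hU hl)]
  · exact (sum_powerset_neg_one_pow_filter_eq_zero
      (fun V => e V i fun l => x (l, i l)) S _ h).symm

/-- A selected part depends on one variable of each row only. -/
theorem selectedPart_congr {e : Finset (Fin k) → (Fin k → ℕ) → (Fin k → ℝ) → E}
    (he : ∀ U i t t', (∀ l ∈ U, t l = t' l) → e U i t = e U i t')
    (Φ : Finset (Fin k → ℕ)) (S : Finset (Fin k)) (J : ℕ → Fin k) (x : Fin k × ℕ → ℝ) :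
    selectedPart e Φ S J x = selectedPart e Φ S J fun p => x (J p.2, p.2) := by
  refine Finset.sum_congr rfl fun i _ => ?_
  split_ifs with h
  · refine Finset.sum_congr rfl fun U hU => ?_
    congr 1
    refine he _ _ _ _ fun l hl => ?_
    simp only [h l (Finset.mem_powerset.1 hU hl)]
  · rfl

/-- The Hoeffding decomposition on the diagonal, each component being written as a multiple of the
average of its selected parts over the choices `J`. -/
theorem sum_eq_sum_selectedPart {e : Finset (Fin k) → (Fin k → ℕ) → (Fin k → ℝ) → E}
    {Φ : Finset (Fin k → ℕ)} (hΦ : ∀ i ∈ Φ, Function.Injective i) (hk : 0 < k) :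
    ∃ 𝒥 : Finset (Fin k) → Finset (ℕ → Fin k), (∀ S, (𝒥 S).Nonempty) ∧ ∀ z : ℕ → ℝ,
      ∑ i ∈ Φ, e Finset.univ i (fun l => z (i l)) = ∑ S : Finset (Fin k),
        ((S.card : ℝ) ^ S.card / (𝒥 S).card) •
          ∑ J ∈ 𝒥 S, selectedPart e Φ S J fun p => z p.2 := by
  have : NeZero k := ⟨hk.ne'⟩
  have hex : ∀ S : Finset (Fin k), ∃ 𝒥 : Finset (ℕ → Fin k), 𝒥.Nonempty ∧
      ∀ i ∈ Φ, (𝒥.filter fun J => ∀ l ∈ S, J (i l) = l).card * S.card ^ S.card = 𝒥.card :=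
    fun S => by
    -- For `S = ∅` nothing has to be selected, and any map serves as `J`; here `0 ^ 0 = 1`.
    rcases S.eq_empty_or_nonempty with rfl | hS
    · exact ⟨{fun _ => 0}, by simp, by simp⟩
    · obtain ⟨𝒥, h1, -, h3⟩ := exists_selectors Φ hS
      exact ⟨𝒥, h1, fun i hi => h3 i hi (hΦ i hi) S id fun _ h => h⟩
  choose 𝒥 h𝒥 hcard using hex
  refine ⟨𝒥, h𝒥, fun z => ?_⟩
  have h : ∀ S : Finset (Fin k), ((S.card : ℝ) ^ S.card / (𝒥 S).card) •
      ∑ J ∈ 𝒥 S, selectedPart e Φ S J (fun p => z p.2) =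
      ∑ i ∈ Φ, ∑ U ∈ S.powerset, (-1 : ℝ) ^ (S.card + U.card) • e U i fun l => z (i l) :=
    fun S => by
    simp only [selectedPart]
    rw [Finset.sum_comm, Finset.smul_sum]
    refine Finset.sum_congr rfl fun i hi => ?_
    have h2 := hcard S i hi
    have h3 : ((𝒥 S).card : ℝ) ≠ 0 := by exact_mod_cast (h𝒥 S).card_pos.ne'
    rw [← Finset.sum_filter, Finset.sum_const, ← Nat.cast_smul_eq_nsmul ℝ, smul_smul]
    rw [← h2] at h3 ⊢
    push_cast at h3 ⊢
    rw [show (S.card : ℝ) ^ S.card / (_ * _) * _ = 1 by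
    rw [div_mul_eq_mul_div, mul_comm, div_self h3], one_smul]
  rw [Finset.sum_congr rfl fun S _ => h S, Finset.sum_comm]
  exact Finset.sum_congr rfl fun i _ =>
    (sum_sum_powerset_neg_one_pow fun U => e U i fun l => z (i l)).symm

end Hoeffding

/-! ### The constants -/

section Constants

variable (k : ℕ)

theorem sum_card_eq_sum_choose (f : ℕ → ℝ) :
    ∑ S : Finset (Fin k), f S.card = ∑ r ∈ Finset.range (k + 1), (k.choose r : ℝ) * f r := by
  rw [← Finset.powerset_univ, Finset.sum_powerset_apply_card f]
  simp

theorem pow_le_decouplingA : (2 * (k : ℝ)) ^ k ≤ decouplingA k := by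
  refine le_trans (le_of_eq ?_) (Finset.single_le_sum
    (f := fun r : ℕ => (k.choose r : ℝ) * (2 * (r : ℝ)) ^ r) (fun r _ => by positivity)
    (Finset.self_mem_range_succ k))
  simp

theorem decouplingA_le_pow : decouplingA k ≤ (2 * (k : ℝ) + 1) ^ k := by
  rw [add_pow, decouplingA]
  refine Finset.sum_le_sum fun r hr => ?_
  have : (r : ℝ) ≤ k := by exact_mod_cast Finset.mem_range_succ_iff.1 hr
  rw [one_pow, mul_one, mul_comm]
  gcongr

theorem pow_div_factorial_le_decouplingB :
    (k : ℝ) ^ k / (k.factorial : ℝ) ≤ decouplingB k := by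
  refine le_trans (le_of_eq ?_) (Finset.single_le_sum
    (f := fun r : ℕ => (k.choose r : ℝ) * ((r : ℝ) ^ k / (k.factorial : ℝ)))
    (fun r _ => by positivity) (Finset.self_mem_range_succ k))
  simp

theorem decouplingB_le : decouplingB k ≤ 2 ^ k * ((k : ℝ) ^ k / (k.factorial : ℝ)) := by
  have h : (2 : ℝ) ^ k = ∑ r ∈ Finset.range (k + 1), (k.choose r : ℝ) := by
    exact_mod_cast (Nat.sum_range_choose k).symm
  rw [h, Finset.sum_mul, decouplingB]
  refine Finset.sum_le_sum fun r hr => ?_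
  have : (r : ℝ) ≤ k := by exact_mod_cast Finset.mem_range_succ_iff.1 hr
  gcongr

end Constants

/-! ### Independent rows -/

/-- Let the columns of a matrix be distributed as `ξ`. If variables chosen one from each row are
independent, as they are when the rows are, then they form a sequence distributed as `ξ`. -/
theorem identDistrib_selection {Ω : Type*} [MeasurableSpace Ω] {μ : Measure Ω}
    [IsProbabilityMeasure μ] {k : ℕ} (hk : 0 < k) {ξ : ℕ → Ω → ℝ} {X : Fin k → ℕ → Ω → ℝ}
    (hξ : ∀ i, Measurable (ξ i)) (hX : ∀ j i, Measurable (X j i))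
    (hlaw : ∀ j, IdentDistrib (fun ω i => X j i ω) (fun ω i => ξ i ω) μ μ)
    (hsel : ∀ J : ℕ → Fin k, iIndepFun (fun i => X (J i) i) μ) (J : ℕ → Fin k) :
    IdentDistrib (fun ω i => X (J i) i ω) (fun ω i => ξ i ω) μ μ := by
  have hcol : ∀ J : ℕ → Fin k, μ.map (fun ω i => X (J i) i ω) =
      Measure.infinitePi fun i => μ.map (ξ i) := fun J => by
    rw [(hsel J).map_fun_eq_infinitePi_map fun i => hX _ _]
    congr 1
    ext1 i
    exact ((hlaw (J i)).comp (measurable_pi_apply i)).map_eq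
  refine ⟨by fun_prop, by fun_prop, ?_⟩
  rw [hcol, ← hcol fun _ => ⟨0, hk⟩]
  exact (hlaw _).map_eq

theorem measurable_prod_piecewise {A : Type*} (B : Set A) [DecidablePred (· ∈ B)] :
    Measurable fun z : (A → ℝ) × (A → ℝ) => B.piecewise z.1 z.2 := by
  refine measurable_pi_lambda _ fun a => ?_
  by_cases ha : a ∈ B <;> simp only [Set.piecewise, ha, if_true, if_false] <;> fun_prop

/-- Resampling the coordinates outside `B` preserves a product measure. -/
theorem map_prod_piecewise_infinitePi {A : Type*} (κ : A → Measure ℝ)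
    [∀ a, IsProbabilityMeasure (κ a)] (B : Set A) [DecidablePred (· ∈ B)] :
    ((Measure.infinitePi κ).prod (Measure.infinitePi κ)).map
      (fun z => B.piecewise z.1 z.2) = Measure.infinitePi κ := by
  classical
  refine Measure.eq_infinitePi κ fun s t ht => ?_
  have hpre : (fun z : (A → ℝ) × (A → ℝ) => B.piecewise z.1 z.2) ⁻¹' Set.pi s t =
      (Set.pi (s.filter (· ∈ B) : Finset A) t) ×ˢ (Set.pi (s.filter (· ∉ B) : Finset A) t) := by
    ext z
    simp only [Set.mem_preimage, Set.mem_pi, Set.mem_prod, Finset.mem_coe, Finset.mem_filter]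
    constructor
    · exact fun h => ⟨fun a ha => by simpa [ha.2] using h a ha.1,
        fun a ha => by simpa [ha.2] using h a ha.1⟩
    · rintro ⟨h1, h2⟩ a ha
      by_cases hB : a ∈ B
      · simpa [hB] using h1 a ⟨ha, hB⟩
      · simpa [hB] using h2 a ⟨ha, hB⟩
  rw [Measure.map_apply (measurable_prod_piecewise B) (.pi s.countable_toSet fun a _ => ht a), hpre,
    Measure.prod_prod,
    Measure.infinitePi_pi _ fun a _ => ht a, Measure.infinitePi_pi _ fun a _ => ht a,
    Finset.prod_filter_mul_prod_filter_not]

/-! ### Conditional means -/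

theorem stronglyMeasurable_sum_apply {k : ℕ} {E : Type*} [NormedAddCommGroup E]
    {F : (Fin k → ℕ) → (Fin k → ℝ) → E}
    (hF : ∀ i, StronglyMeasurable (F i)) (Φ : Finset (Fin k → ℕ)) :
    StronglyMeasurable fun x : Fin k × ℕ → ℝ => ∑ i ∈ Φ, F i fun l => x (l, i l) :=
  Finset.stronglyMeasurable_fun_sum _ fun i _ => (hF i).comp_measurable (by fun_prop)

theorem stronglyMeasurable_uStat {k : ℕ} {E : Type*} [NormedAddCommGroup E]
    {F : (Fin k → ℕ) → (Fin k → ℝ) → E} (hF : ∀ i, StronglyMeasurable (F i))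
    (hF1 : (Function.support F).Finite) :
    StronglyMeasurable fun x : Fin k → ℕ → ℝ => uStat F x := by
  simp only [uStat_eq_sum hF1]
  exact Finset.stronglyMeasurable_fun_sum _ fun i _ => (hF i).comp_measurable (by fun_prop)

section CondMean

variable {k : ℕ} {E : Type*} [NormedAddCommGroup E] [NormedSpace ℝ E]

/-- The conditional mean of `F i`, evaluated at the matrix with law `P`, given that its variables
with numbers `l ∈ V` take the values `t l`. -/
noncomputable def condMean (P : Measure (Fin k × ℕ → ℝ)) (F : (Fin k → ℕ) → (Fin k → ℝ) → E)
    (V : Finset (Fin k)) (i : Fin k → ℕ) (t : Fin k → ℝ) : E :=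
  ∫ y, F i (V.piecewise t fun l => y (l, i l)) ∂P

theorem condMean_univ (P : Measure (Fin k × ℕ → ℝ)) [IsProbabilityMeasure P] [CompleteSpace E]
    (F : (Fin k → ℕ) → (Fin k → ℝ) → E) (i : Fin k → ℕ) (t : Fin k → ℝ) :
    condMean P F Finset.univ i t = F i t := by
  simp [condMean]

theorem condMean_congr (P : Measure (Fin k × ℕ → ℝ)) (F : (Fin k → ℕ) → (Fin k → ℝ) → E)
    (V : Finset (Fin k)) (i : Fin k → ℕ) (t t' : Fin k → ℝ) (h : ∀ l ∈ V, t l = t' l) :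
    condMean P F V i t = condMean P F V i t' := by
  have : ∀ u : Fin k → ℝ, V.piecewise t u = V.piecewise t' u := fun u =>
    V.piecewise_congr h fun _ _ => rfl
  simp only [condMean, this]

theorem stronglyMeasurable_condMean (P : Measure (Fin k × ℕ → ℝ)) [IsProbabilityMeasure P]
    {F : (Fin k → ℕ) → (Fin k → ℝ) → E} (hF : ∀ i, StronglyMeasurable (F i))
    (V : Finset (Fin k)) (i : Fin k → ℕ) : StronglyMeasurable (condMean P F V i) := by
  refine StronglyMeasurable.integral_prod_right' (f := fun z : (Fin k → ℝ) × (Fin k × ℕ → ℝ) =>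
    F i (V.piecewise z.1 fun l => z.2 (l, i l))) ((hF i).comp_measurable ?_)
  refine measurable_pi_lambda _ fun l => ?_
  by_cases hl : l ∈ V <;> simp only [Finset.piecewise, hl, if_true, if_false] <;> fun_prop

theorem stronglyMeasurable_sum_condMean (P : Measure (Fin k × ℕ → ℝ)) [IsProbabilityMeasure P]
    {F : (Fin k → ℕ) → (Fin k → ℝ) → E} (hF : ∀ i, StronglyMeasurable (F i))
    (Φ : Finset (Fin k → ℕ)) (V : (Fin k → ℕ) → Finset (Fin k)) :
    StronglyMeasurable fun x : Fin k × ℕ → ℝ =>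
      ∑ i ∈ Φ, condMean P F (V i) i fun l => x (l, i l) :=
  stronglyMeasurable_sum_apply (fun i => stronglyMeasurable_condMean P hF (V i) i) Φ

namespace RISpace

variable {Ω : Type*} [MeasurableSpace Ω] {μ : Measure Ω} (L : RISpace μ)

/-- Taking the conditional mean of a U-statistic given the entries of the matrix in a set of
positions, those `(l, a)` with `l ∈ U` and `J a = l`, does not increase the norm. -/
theorem maxNorm_sum_condMean_le (hμ : CarriesIndependentSequences μ) (κ : Fin k × ℕ → Measure ℝ)
    [∀ p, IsProbabilityMeasure (κ p)] {F : (Fin k → ℕ) → (Fin k → ℝ) → E}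
    (hF : ∀ i, StronglyMeasurable (F i)) (Φ : Finset (Fin k → ℕ))
    (hint : ∀ i ∈ Φ, Integrable (fun x : Fin k × ℕ → ℝ => F i fun l => x (l, i l))
      (Measure.infinitePi κ)) (U : Finset (Fin k)) (J : ℕ → Fin k) :
    L.maxNorm (Measure.infinitePi κ) (fun x => ‖∑ i ∈ Φ, condMean (Measure.infinitePi κ) F
        (U.filter fun l => J (i l) = l) i fun l => x (l, i l)‖) ≤
      L.maxNorm (Measure.infinitePi κ) fun x => ‖∑ i ∈ Φ, F i fun l => x (l, i l)‖ := by
  classical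
  set P := Measure.infinitePi κ with hP
  set B : Set (Fin k × ℕ) := {p | p.1 ∈ U ∧ J p.2 = p.1}
  set w : (Fin k × ℕ → ℝ) × (Fin k × ℕ → ℝ) → Fin k × ℕ → ℝ := fun z => B.piecewise z.1 z.2
  have hw : Measurable w := measurable_prod_piecewise B
  have hmap : (P.prod P).map w = P := map_prod_piecewise_infinitePi κ B
  have hw' : ∀ (i : Fin k → ℕ) x y, (fun l => w (x, y) (l, i l)) =
      (U.filter fun l => J (i l) = l).piecewise (fun l => x (l, i l)) fun l => y (l, i l) :=
    fun i x y => by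
    ext l
    simp [w, B, Set.piecewise, Finset.piecewise]
  have hθ := (stronglyMeasurable_sum_apply hF Φ).norm.measurable
  have hid : IdentDistrib (fun z => ‖∑ i ∈ Φ, F i fun l => w z (l, i l)‖)
      (fun x : Fin k × ℕ → ℝ => ‖∑ i ∈ Φ, F i fun l => x (l, i l)‖) (P.prod P) P :=
    IdentDistrib.comp (f := w) (g := id) ⟨hw.aemeasurable, aemeasurable_id, by simpa using hmap⟩ hθ
  rw [← L.maxNorm_eq_of_identDistrib hid]
  refine L.maxNorm_le_of_le_lintegral hμ (hθ.comp hw)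
    (stronglyMeasurable_sum_condMean P hF Φ _).norm.measurable.aemeasurable ?_
  have hint' : ∀ᵐ x ∂P, ∀ i ∈ Φ, Integrable (fun y => F i fun l => w (x, y) (l, i l)) P := by
    rw [Finset.eventually_all]
    intro i hi
    refine Integrable.prod_right_ae (f := fun z => F i fun l => w z (l, i l)) ?_
    exact Integrable.comp_measurable (g := fun x : Fin k × ℕ → ℝ => F i fun l => x (l, i l))
      (by rw [hmap]; exact hint i hi) hw
  filter_upwards [hint'] with x hx
  have h : ∑ i ∈ Φ, condMean P F (U.filter fun l => J (i l) = l) i (fun l => x (l, i l)) =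
      ∫ y, ∑ i ∈ Φ, F i (fun l => w (x, y) (l, i l)) ∂P := by
    rw [integral_finsetSum _ hx]
    refine Finset.sum_congr rfl fun i _ => ?_
    simp only [hw', condMean]
  rw [h]
  simp only [enorm_norm, Function.comp_apply]
  exact enorm_integral_le_lintegral_enorm _

theorem maxNorm_selectedPart_le (hμ : CarriesIndependentSequences μ) (κ : Fin k × ℕ → Measure ℝ)
    [∀ p, IsProbabilityMeasure (κ p)] {F : (Fin k → ℕ) → (Fin k → ℝ) → E}
    (hF : ∀ i, StronglyMeasurable (F i)) (Φ : Finset (Fin k → ℕ))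
    (hint : ∀ i ∈ Φ, Integrable (fun x : Fin k × ℕ → ℝ => F i fun l => x (l, i l))
      (Measure.infinitePi κ)) (S : Finset (Fin k)) (J : ℕ → Fin k) :
    L.maxNorm (Measure.infinitePi κ)
        (fun x => ‖selectedPart (condMean (Measure.infinitePi κ) F) Φ S J x‖) ≤
      2 ^ S.card *
        L.maxNorm (Measure.infinitePi κ) fun x => ‖∑ i ∈ Φ, F i fun l => x (l, i l)‖ := by
  simp only [selectedPart_eq_sum]
  refine (L.maxNorm_norm_sum_smul_le hμ _ _ fun U =>
    (stronglyMeasurable_sum_condMean _ hF Φ _).aestronglyMeasurable).trans ?_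
  refine (Finset.sum_le_sum fun U _ =>
    mul_le_mul_right (L.maxNorm_sum_condMean_le hμ κ hF Φ hint U J) _).trans_eq ?_
  simp [enorm_pow, Finset.card_powerset]

end RISpace

end CondMean

/-! ### The decoupling inequalities -/

section Decoupling

variable {Ω : Type*} [MeasurableSpace Ω] {μ : Measure Ω} [IsProbabilityMeasure μ] (L : RISpace μ)
  {E : Type*} [NormedAddCommGroup E] [NormedSpace ℝ E] {k : ℕ}
  {F : (Fin k → ℕ) → (Fin k → ℝ) → E} {ξ : ℕ → Ω → ℝ} {X : Fin k → ℕ → Ω → ℝ}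

theorem vnorm_uStat_symmetrization_le (hk : 0 < k) (hF : ∀ i, StronglyMeasurable (F i))
    (hF0 : ∀ i : Fin k → ℕ, ¬ Function.Injective i → F i = 0)
    (hF1 : (Function.support F).Finite)
    (hξ : ∀ i, Measurable (ξ i)) (hX : ∀ j i, Measurable (X j i))
    (hlaw : ∀ j, IdentDistrib (fun ω i => X j i ω) (fun ω i => ξ i ω) μ μ)
    (hrows : iIndepFun (fun (i : ℕ) ω (j : Fin k) => X j i ω) μ) :
    L.vnorm (fun ω => uStat (symmetrization F) (fun j i => X j i ω)) ≤
      ENNReal.ofReal (decouplingB k) * L.vnorm (fun ω => uStat F (fun _ i => ξ i ω)) := by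
  obtain ⟨𝒥, h𝒥, hsum⟩ := uStat_symmetrization_eq_sum hk hF0 hF1
  have hU := stronglyMeasurable_uStat hF hF1
  have hm : ∀ J : ℕ → Fin k, AEStronglyMeasurable
      (fun ω => uStat F fun _ a => X (J a) a ω) μ := fun J =>
    (hU.comp_measurable (g := fun ω _ a => X (J a) a ω) (by fun_prop)).aestronglyMeasurable
  have hdiag : ∀ J : ℕ → Fin k, L.vnorm (fun ω => uStat F fun _ a => X (J a) a ω) =
      L.vnorm (fun ω => uStat F fun _ i => ξ i ω) := fun J =>
    L.vnorm_eq_of_identDistrib (θ := fun z : ℕ → ℝ => uStat F fun _ => z)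
      (hU.comp_measurable (by fun_prop))
      (identDistrib_selection hk hξ hX hlaw (fun J =>
        hrows.comp (fun i row => row (J i)) fun i => measurable_pi_apply _) J)
  simp only [hsum]
  refine (L.vnorm_sum_le _ fun S => (Finset.aestronglyMeasurable_fun_sum _ fun J _ =>
    hm J).const_smul _).trans ?_
  rw [decouplingB, ← sum_card_eq_sum_choose k (fun r => (r : ℝ) ^ k / (k.factorial : ℝ)),
    ENNReal.ofReal_sum_of_nonneg fun S _ => by positivity, Finset.sum_mul]
  refine Finset.sum_le_sum fun S _ => ?_
  refine (L.vnorm_smul _ (Finset.aestronglyMeasurable_fun_sum _ fun J _ => hm J)).le.trans ?_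
  refine (mul_le_mul_right (L.vnorm_sum_le _ hm) _).trans_eq ?_
  have hc : ((𝒥 S).card : ℝ) ≠ 0 := by exact_mod_cast (h𝒥 S).card_pos.ne'
  simp only [hdiag, Finset.sum_const, nsmul_eq_mul]
  rw [← mul_assoc, ← ENNReal.ofReal_natCast, Real.enorm_eq_ofReal_abs,
    ← ENNReal.ofReal_mul (abs_nonneg _)]
  congr 2
  rw [abs_mul, abs_mul, abs_pow, abs_neg, abs_one, one_pow, one_mul,
    abs_of_nonneg (by positivity), abs_of_nonneg (by positivity)]
  field_simp

theorem vnorm_uStat_diag_le [CompleteSpace E] (hμ : CarriesIndependentSequences μ) (hk : 0 < k)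
    (hF : ∀ i, StronglyMeasurable (F i))
    (hF0 : ∀ i : Fin k → ℕ, ¬ Function.Injective i → F i = 0)
    (hF1 : (Function.support F).Finite)
    (hξ : ∀ i, Measurable (ξ i)) (hX : ∀ j i, Measurable (X j i))
    (hlaw : ∀ j, IdentDistrib (fun ω i => X j i ω) (fun ω i => ξ i ω) μ μ)
    (hF2 : ∀ i : Fin k → ℕ, L.vnorm (fun ω => F i (fun j => ξ (i j) ω)) < ∞)
    (hind : ∀ j, iIndepFun (X j) μ)
    (hcols : iIndepFun (fun (j : Fin k) ω (i : ℕ) => X j i ω) μ) :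
    L.vnorm (fun ω => uStat F (fun _ i => ξ i ω)) ≤
      ENNReal.ofReal (decouplingA k) * L.vnorm (fun ω => uStat F (fun j i => X j i ω)) := by
  have hall : iIndepFun (fun p : Fin k × ℕ => X p.1 p.2) μ := iIndepFun_uncurry' hX hcols hind
  have : NeZero k := ⟨hk.ne'⟩
  have : ∀ p : Fin k × ℕ, IsProbabilityMeasure (μ.map (X p.1 p.2)) := fun p =>
    Measure.isProbabilityMeasure_map (hX _ _).aemeasurable
  set P := Measure.infinitePi fun p : Fin k × ℕ => μ.map (X p.1 p.2) with hP
  have hXm : Measurable fun ω (p : Fin k × ℕ) => X p.1 p.2 ω := by fun_prop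
  have hPmap : μ.map (fun ω (p : Fin k × ℕ) => X p.1 p.2 ω) = P :=
    hall.map_fun_eq_infinitePi_map fun p => hX _ _
  have hXP : IdentDistrib (fun ω (p : Fin k × ℕ) => X p.1 p.2 ω) id μ P :=
    ⟨hXm.aemeasurable, aemeasurable_id, by rw [hPmap, Measure.map_id]⟩
  set Φ := hF1.toFinset
  have hinj : ∀ i ∈ Φ, Function.Injective i := fun i hi => by
    by_contra h
    exact (hF1.mem_toFinset.1 hi) (hF0 i h)
  have hFm : ∀ i : Fin k → ℕ, StronglyMeasurable fun ω => F i fun j => ξ (i j) ω := fun i =>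
    (hF i).comp_measurable (by fun_prop)
  have hsel := identDistrib_selection hk hξ hX hlaw fun J =>
    hall.precomp (g := fun i => (J i, i)) fun _ _ h => (Prod.mk.inj h).2
  have hint : ∀ i ∈ Φ, Integrable (fun x : Fin k × ℕ → ℝ => F i fun l => x (l, i l)) P := by
    intro i hi
    -- As `i` is injective, some `J` selects the variables `X l (i l)`, so `F i` has the same law
    -- there as on the diagonal.
    have h1 : Integrable (fun ω => F i fun j => ξ (i j) ω) μ :=
      (integrable_norm_iff (hFm i).aestronglyMeasurable).1
        (L.integrable _ (hFm i).norm.measurable.aemeasurable (hF2 i))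
    have h2 := ((hsel (Function.invFun i)).comp (u := fun (z : ℕ → ℝ) l => z (i l)) (by fun_prop))
    simp only [Function.comp_def, Function.leftInverse_invFun (hinj i hi) _] at h2
    have h3 : Integrable (F i) (μ.map fun ω l => ξ (i l) ω) :=
      (integrable_map_measure (hF i).aestronglyMeasurable h2.aemeasurable_snd).2 h1
    rw [← h2.map_eq] at h3
    rw [← hPmap]
    exact (integrable_map_measure (g := fun x : Fin k × ℕ → ℝ => F i fun l => x (l, i l))
      ((hF i).comp_measurable (by fun_prop)).aestronglyMeasurable hXm.aemeasurable).2
      ((integrable_map_measure (hF i).aestronglyMeasurable h2.aemeasurable_fst).1 h3)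
  set C := L.maxNorm P fun x => ‖∑ i ∈ Φ, F i fun l => x (l, i l)‖ with hC
  have hsm := stronglyMeasurable_uStat hF hF1
  have hCX : C ≤ L.vnorm (fun ω => uStat F (fun j i => X j i ω)) := by
    have h := hXP.comp (stronglyMeasurable_sum_apply hF Φ).norm.measurable
    rw [hC]
    refine (L.maxNorm_eq_of_identDistrib h).symm.le.trans ?_
    refine (L.maxNorm_le_nrm h.aemeasurable_fst).trans_eq ?_
    simp only [RISpace.vnorm, uStat_eq_sum hF1]
    rfl
  -- The law of a selected part is the same on the diagonal and at the decoupled matrix.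
  set e := condMean P F
  have hselm : ∀ S J, StronglyMeasurable (selectedPart e Φ S J) := fun S J => by
    have h : selectedPart e Φ S J = fun x => selectedPart e Φ S J x := rfl
    rw [h]
    simp only [selectedPart_eq_sum]
    exact Finset.stronglyMeasurable_fun_sum _ fun U _ =>
      (stronglyMeasurable_sum_condMean P hF Φ _).const_smul _
  have hpart : ∀ S J, L.maxNorm μ (fun ω => ‖selectedPart e Φ S J fun p => ξ p.2 ω‖) ≤
      2 ^ S.card * C := fun S J => by
    refine le_trans (le_of_eq ?_) (L.maxNorm_selectedPart_le hμ _ hF Φ hint S J)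
    have h1 := (hsel J).comp (u := fun z : ℕ → ℝ => ‖selectedPart e Φ S J fun p => z p.2‖)
      ((hselm S J).norm.measurable.comp (by fun_prop))
    have h2 := hXP.comp (hselm S J).norm.measurable
    refine (L.maxNorm_eq_of_identDistrib h1).symm.trans (Eq.trans ?_
      (L.maxNorm_eq_of_identDistrib h2))
    congr 1
    ext ω
    simp only [Function.comp_apply]
    rw [selectedPart_congr (condMean_congr P F) Φ S J fun p => X p.1 p.2 ω]
  -- The diagonal value lies in the space, where its norm can be replaced by `maxNorm`.
  have hfin : L.vnorm (fun ω => uStat F (fun _ i => ξ i ω)) < ∞ := by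
    simp only [uStat_eq_sum hF1]
    refine (L.vnorm_sum_le _ fun i => (hFm i).aestronglyMeasurable).trans_lt ?_
    exact ENNReal.sum_lt_top.2 fun i _ => hF2 i
  have hdiagm : StronglyMeasurable fun ω => uStat F fun _ i => ξ i ω :=
    hsm.comp_measurable (g := fun ω _ i => ξ i ω) (by fun_prop)
  obtain ⟨𝒥, h𝒥, hsum⟩ := sum_eq_sum_selectedPart (e := e) hinj hk
  simp only [e, condMean_univ] at hsum
  rw [RISpace.vnorm, ← L.maxNorm_eq_nrm hdiagm.norm.measurable.aemeasurable hfin]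
  refine le_trans ?_ (mul_le_mul_right hCX _)
  simp only [uStat_eq_sum hF1]
  refine le_trans (le_of_eq (congrArg _ (funext fun ω => congrArg _ (hsum fun a => ξ a ω)))) ?_
  have hpm : ∀ S J, AEStronglyMeasurable (fun ω => selectedPart e Φ S J fun p => ξ p.2 ω) μ :=
    fun S J => ((hselm S J).comp_measurable (by fun_prop)).aestronglyMeasurable
  refine (L.maxNorm_norm_sum_smul_le hμ _ _ fun S =>
    Finset.aestronglyMeasurable_fun_sum _ fun J _ => hpm S J).trans ?_
  rw [decouplingA, ← sum_card_eq_sum_choose k (fun r => (2 * (r : ℝ)) ^ r),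
    ENNReal.ofReal_sum_of_nonneg fun S _ => by positivity, Finset.sum_mul]
  refine Finset.sum_le_sum fun S _ => ?_
  have hone : L.maxNorm μ (fun ω => ‖∑ J ∈ 𝒥 S, selectedPart e Φ S J fun p => ξ p.2 ω‖) ≤
      (𝒥 S).card * (2 ^ S.card * C) := by
    have h := L.maxNorm_norm_sum_smul_le hμ (𝒥 S) (fun _ => 1) (hpm S)
    simp only [one_smul, enorm_one, one_mul] at h
    refine h.trans ((Finset.sum_le_sum fun J _ => hpart S J).trans_eq ?_)
    simp
  refine (mul_le_mul_right hone _).trans_eq ?_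
  have hc : ((𝒥 S).card : ℝ) ≠ 0 := by exact_mod_cast (h𝒥 S).card_pos.ne'
  have h2 : (2 : ℝ≥0∞) ^ S.card = ENNReal.ofReal (2 ^ S.card) := by
    rw [ENNReal.ofReal_pow (by norm_num)]
    simp
  rw [h2, ← mul_assoc, ← mul_assoc, ← ENNReal.ofReal_natCast, Real.enorm_eq_ofReal_abs,
    ← ENNReal.ofReal_mul (abs_nonneg _), ← ENNReal.ofReal_mul (by positivity),
    abs_of_nonneg (by positivity)]
  congr 2
  rw [mul_pow]
  field_simp

end Decoupling

theorem theoremF {Ω : Type*} [MeasurableSpace Ω] (μ : Measure Ω) [IsProbabilityMeasure μ]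
    (hμ : CarriesIndependentSequences μ) (L : RISpace μ)
    {E : Type*} [NormedAddCommGroup E] [NormedSpace ℝ E] [CompleteSpace E]
    (k : ℕ) (hk : 0 < k)
    (F : (Fin k → ℕ) → (Fin k → ℝ) → E)
    (hF : ∀ i, StronglyMeasurable (F i))
    (hF0 : ∀ i : Fin k → ℕ, ¬ Function.Injective i → F i = 0)
    (hF1 : (Function.support F).Finite)
    (ξ : ℕ → Ω → ℝ) (X : Fin k → ℕ → Ω → ℝ)
    (hξ : ∀ i, Measurable (ξ i)) (hX : ∀ j i, Measurable (X j i))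
    -- each column `X j` is distributed as the sequence `ξ`
    (hlaw : ∀ j, IdentDistrib (fun ω i => X j i ω) (fun ω i => ξ i ω) μ μ)
    (hF2 : ∀ i : Fin k → ℕ, L.vnorm (fun ω => F i (fun j => ξ (i j) ω)) < ∞) :
    -- (A') independent columns, each consisting of independent variables
    ((∀ j, iIndepFun (X j) μ) → iIndepFun (fun (j : Fin k) ω (i : ℕ) => X j i ω) μ →
      L.vnorm (fun ω => uStat F (fun _ i => ξ i ω)) ≤
        ENNReal.ofReal (decouplingA k) * L.vnorm (fun ω => uStat F (fun j i => X j i ω))) ∧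
    -- (B') interchangeable columns, the rows being independent
    (iIndepFun (fun (i : ℕ) ω (j : Fin k) => X j i ω) μ → Interchangeable μ X →
      L.vnorm (fun ω => uStat (symmetrization F) (fun j i => X j i ω)) ≤
        ENNReal.ofReal (decouplingB k) * L.vnorm (fun ω => uStat F (fun _ i => ξ i ω))) ∧
    -- size of the constants
    ((2 * (k : ℝ)) ^ k ≤ decouplingA k ∧ decouplingA k ≤ (2 * (k : ℝ) + 1) ^ k) ∧
    ((k : ℝ) ^ k / (k.factorial : ℝ) ≤ decouplingB k ∧
      decouplingB k ≤ 2 ^ k * ((k : ℝ) ^ k / (k.factorial : ℝ))) := by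
  refine ⟨fun hind hcols => ?_, fun hrows _ => ?_, ⟨pow_le_decouplingA k, decouplingA_le_pow k⟩,
    pow_div_factorial_le_decouplingB k, decouplingB_le k⟩
  · exact vnorm_uStat_diag_le L hμ hk hF hF0 hF1 hξ hX hlaw hF2 hind hcols
  · exact vnorm_uStat_symmetrization_le L hk hF hF0 hF1 hξ hX hlaw hrows
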